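/- Let $\mu,\kappa,\alpha,\beta,\gamma,\tau,\lambda,\nu\in\mathbb R$ satisfy $\mu>0$, $\kappa>0$, $\tilde\alpha:=\alpha+\tfrac{4\beta}{3}>0$, $\tilde\gamma:=\beta+\gamma>0$, $\tau>0$ and $\lambda>\nu>0$. Put $d=\frac{\tau}{2\kappa}$ and $J_{eq}=\operatorname{diag}(\lambda,\lambda,\nu)$. For $k\in\mathbb R^3$ let $k\times$ be the matrix of $v\mapsto k\times v$, let $P_\parallel(k)=\frac{k\otimes k}{|k|^2}$ (with $P_\parallel(0)=0$), $P_\perp(k)=I-P_\parallel(k)$, let $$R_{22}=\begin{pmatrix}0&-1\\1&0\end{pmatrix},\quad R_{23}=\begin{pmatrix}0&-1&0\\1&0&0\end{pmatrix},\quad R_{32}=\begin{pmatrix}0&-1\\1&0\\0&0\end{pmatrix},\quad R_{33}=\begin{pmatrix}0&-1&0\\1&0&0\\0&0&0\end{pmatrix},$$ and define the complex $8\times 8$ matrix $$\hat{\mathcal B}_k=\begin{pmatrix}-(\mu+\frac\kappa2)|k|^2P_\perp(k)& i\kappa\,k\times&0\\ J_{eq}^{-1}(i\kappa\,k\times)P_\perp(k)&-2\kappa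 J_{eq}^{-1}-\tilde\alpha|k|^2J_{eq}^{-1}P_\parallel(k)-\tilde\gamma|k|^2J_{eq}^{-1}P_\perp(k)-(1-\frac\nu\lambda)d\,R_{33}&-\frac{d^2}{\lambda}R_{32}\\0&(\lambda-\nu)R_{23}&d\,R_{22}\end{pmatrix}.$$ With $s=-\frac{d}{\sqrt{\lambda-\nu}}$, $T(k)=\frac{i\,k\times}{|k|}$ for $k\ne0$ and $T(0)=0$, put $$M(k)=\big(T(k)\oplus J_{eq}^{1/2}\oplus sR_{22}\big)\,\hat{\mathcal B}_k\,\big(T(k)\oplus J_{eq}^{-1/2}\oplus(-s^{-1})R_{22}\big).$$ Let $\mathcal L$ be the Leray-projected linearization, about the equilibrium $(u,\omega,J)=(0,d\,e_3,J_{eq})$, of the incompressible micropolar fluid equations on $\mathbb T^3=\mathbb R^3/(2\pi\mathbb Z)^3$ with microtorque $\tau e_3$. Writing the unknown as $(Y,\bar J,J_{33})$, where $Y=(u,\omega,a)$, $a=(J_{13},J_{23})$ and $\bar J$ is the upper left $2\times2$ block of $J$, it is the Fourier multiplier $\mathcal L=\mathcal B\oplus d\,[R_{22},\cdot\,]\oplus0$,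 where $\mathcal B$ has symbol $\hat{\mathcal B}_k$, $k\in\mathbb Z^3$; it acts on complex-valued $L^2(\mathbb T^3)$ with domain $\{u,\omega\in H^2,\ a,\bar J,J_{33}\in L^2\}$. Then: 1. There exist $K_T>0$ and a function $z:\{k\in\mathbb R^3:|k|>K_T\}\to\mathbb C$, continuously differentiable in the real sense, such that for every $k\in\mathbb R^3$ with $|k|>K_T$ both $z(k)$ and $\overline{z(k)}$ are eigenvalues of $M(k)$ and $\operatorname{Re}z(k)>0$; moreover $z(k)\to\frac{i\tau}{2\kappa}$ as $|k|\to\infty$. 2. All but finitely many Fourier modes are unstable: for all but finitely many $k\in\mathbb Z^3$ the matrix $\hat{\mathcal B}_k$ has an eigenvalue with strictly positive real part. 3. There is no spectral gap: for every $\delta>0$ the operator $\mathcal L$ has an eigenvalue $w$ with $0<\operatorname{Re}w<\delta$. -/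

import Mathlib

open scoped Matrix

namespace Micropolar

/-- The physical parameters: viscosities `μ, κ, α, β, γ`, the microtorque `τ`, and the principal
moments of inertia: the microinertia has spectrum `{lam, lam, nu}`. -/
structure Params where
  μ : ℝ
  κ : ℝ
  α : ℝ
  β : ℝ
  γ : ℝ
  τ : ℝ
  lam : ℝ
  nu : ℝ

/-- The standing assumptions: `μ, κ, α + 4β/3, β + γ > 0`, `τ > 0`, `nu > 0`, and the
microstructure is inertially oblong, `lam > nu`. -/
structure Params.Admissible (p : Params) : Prop where
  μ_pos : 0 < p.μ
  κ_pos : 0 < p.κ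
  α_pos : 0 < p.α + 4 * p.β / 3
  γ_pos : 0 < p.β + p.γ
  τ_pos : 0 < p.τ
  nu_pos : 0 < p.nu
  oblong : p.nu < p.lam

/-- Wavenumbers `k ∈ ℝ³`, with the Euclidean norm. -/
abbrev Wave := EuclideanSpace ℝ (Fin 3)

/-- An integer wavenumber `n ∈ ℤ³`, seen in `ℝ³`. -/
noncomputable def intWave (n : Fin 3 → ℤ) : Wave := WithLp.toLp 2 (fun i => (n i : ℝ))

/-- Indices of the eight components `(u, ω, a) ∈ ℝ³ × ℝ³ × ℝ²`. -/
abbrev Idx := Fin 3 ⊕ Fin 3 ⊕ Fin 2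

/-- The matrix of `v ↦ k × v`. -/
def cross (k : Wave) : Matrix (Fin 3) (Fin 3) ℝ :=
  !![0, -k 2, k 1; k 2, 0, -k 0; -k 1, k 0, 0]

/-- The orthogonal projection onto the span of `k` (it is `0` for `k = 0`). -/
noncomputable def Ppar (k : Wave) : Matrix (Fin 3) (Fin 3) ℝ :=
  (‖k‖ ^ 2)⁻¹ • Matrix.vecMulVec k k

/-- The orthogonal projection onto the orthogonal complement of `k`. -/
noncomputable def Pperp (k : Wave) : Matrix (Fin 3) (Fin 3) ℝ := 1 - Ppar k

def R22 : Matrix (Fin 2) (Fin 2) ℝ := !![0, -1; 1, 0]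
def R23 : Matrix (Fin 2) (Fin 3) ℝ := !![0, -1, 0; 1, 0, 0]
def R32 : Matrix (Fin 3) (Fin 2) ℝ := !![0, -1; 1, 0; 0, 0]
def R33 : Matrix (Fin 3) (Fin 3) ℝ := !![0, -1, 0; 1, 0, 0; 0, 0, 0]

/-- Complexification of a real matrix. -/
def toC {m n : Type} (A : Matrix m n ℝ) : Matrix m n ℂ := A.map (fun x => (x : ℂ))

/-- An `8 × 8` matrix from its nine blocks. -/
def blocks (A₁₁ A₁₂ : Matrix (Fin 3) (Fin 3) ℂ) (A₁₃ : Matrix (Fin 3) (Fin 2) ℂ)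
    (A₂₁ A₂₂ : Matrix (Fin 3) (Fin 3) ℂ) (A₂₃ : Matrix (Fin 3) (Fin 2) ℂ)
    (A₃₁ A₃₂ : Matrix (Fin 2) (Fin 3) ℂ) (A₃₃ : Matrix (Fin 2) (Fin 2) ℂ) :
    Matrix Idx Idx ℂ :=
  Matrix.fromBlocks A₁₁ (Matrix.fromCols A₁₂ A₁₃) (Matrix.fromRows A₂₁ A₃₁)
    (Matrix.fromBlocks A₂₂ A₂₃ A₃₂ A₃₃)

namespace Params

variable (p : Params)

/-- The equilibrium angular speed `τ / (2κ)`. -/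
noncomputable def d : ℝ := p.τ / (2 * p.κ)

/-- `J_eq⁻¹`, where `J_eq = diag (lam, lam, nu)`. -/
noncomputable def JInv : Matrix (Fin 3) (Fin 3) ℝ :=
  Matrix.diagonal ![p.lam⁻¹, p.lam⁻¹, p.nu⁻¹]

/-- `J_eq^{1/2}`. -/
noncomputable def JSqrt : Matrix (Fin 3) (Fin 3) ℝ :=
  Matrix.diagonal ![√p.lam, √p.lam, √p.nu]

/-- `J_eq^{-1/2}`. -/
noncomputable def JInvSqrt : Matrix (Fin 3) (Fin 3) ℝ :=
  Matrix.diagonal ![(√p.lam)⁻¹, (√p.lam)⁻¹, (√p.nu)⁻¹]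

/-- The symbol at wavenumber `k` of the block of the Leray-projected linearized operator that
governs `(u, ω, a)`, where `a = (J₁₃, J₂₃)`. -/
noncomputable def BHat (k : Wave) : Matrix Idx Idx ℂ :=
  blocks
    (toC (-((p.μ + p.κ / 2) * ‖k‖ ^ 2) • Pperp k))
    (Complex.I • toC (p.κ • cross k))
    0
    (Complex.I • toC (p.κ • (p.JInv * cross k * Pperp k)))
    (toC (-(2 * p.κ) • p.JInv
      - ((p.α + 4 * p.β / 3) * ‖k‖ ^ 2) • (p.JInv * Ppar k)
      - ((p.β + p.γ) * ‖k‖ ^ 2) • (p.JInv * Pperp k)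
      - ((1 - p.nu / p.lam) * p.d) • R33))
    (toC (-(p.lam⁻¹ * p.d ^ 2) • R32))
    0
    (toC ((p.lam - p.nu) • R23))
    (toC (p.d • R22))

/-- `T(k) = i k× / |k|`, and `T(0) = 0`. -/
noncomputable def T (k : Wave) : Matrix (Fin 3) (Fin 3) ℂ :=
  Complex.I • toC (‖k‖⁻¹ • cross k)

/-- `s = - (τ / (2κ)) / √(lam - nu)`. -/
noncomputable def s : ℝ := -1 / √(p.lam - p.nu) * p.d

/-- `Q_k = T(k) ⊕ J_eq^{1/2} ⊕ s R₂₂`. -/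
noncomputable def Q (k : Wave) : Matrix Idx Idx ℂ :=
  blocks (T k) 0 0 0 (toC p.JSqrt) 0 0 0 (toC (p.s • R22))

/-- `Q̄_k = T(k) ⊕ J_eq^{-1/2} ⊕ (-s⁻¹) R₂₂`. -/
noncomputable def QBar (k : Wave) : Matrix Idx Idx ℂ :=
  blocks (T k) 0 0 0 (toC p.JInvSqrt) 0 0 0 (toC (-p.s⁻¹ • R22))

/-- `M(k) = Q_k B̂_k Q̄_k`. -/
noncomputable def M (k : Wave) : Matrix Idx Idx ℂ := p.Q k * p.BHat k * p.QBar k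

end Params

/-- `w` is a (complex) eigenvalue of the matrix `A`. -/
def IsEigenvalue (A : Matrix Idx Idx ℂ) (w : ℂ) : Prop :=
  Module.End.HasEigenvalue (Matrix.toLin' A) w

/-- The Fourier mode `n ∈ ℤ³` of the linearized problem is unstable: its symbol has an eigenvalue
with strictly positive real part. -/
def UnstableMode (p : Params) (n : Fin 3 → ℤ) : Prop :=
  ∃ w : ℂ, IsEigenvalue (p.BHat (intWave n)) w ∧ 0 < w.re

/-! The linearized operator on the torus `𝕋³ = ℝ³ / (2πℤ)³`. -/

instance twoPiPos : Fact (0 < 2 * Real.pi) := ⟨Real.two_pi_pos⟩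

abbrev Torus := Fin 3 → AddCircle (2 * Real.pi)

/-- The normalized Haar measure on the torus. -/
noncomputable def haar : MeasureTheory.Measure Torus :=
  MeasureTheory.Measure.pi (fun _ => AddCircle.haarAddCircle)

/-- Complex-valued `L²` functions on the torus. -/
noncomputable abbrev L2 := MeasureTheory.Lp ℂ 2 haar

/-- The Fourier coefficient `f̂(n) = ∫ e^{-i n·x} f(x) dx`. -/
noncomputable def coeff (f : L2) (n : Fin 3 → ℤ) : ℂ :=
  ∫ x, (∏ i, fourier (-(n i)) (x i)) * f x ∂haar

/-- States `((u, ω, a), J̄, J₃₃)`, where `J̄` is the upper left `2 × 2` block of the perturbation of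
the microinertia and `a` is its upper right `2 × 1` block. -/
abbrev State := (Idx → L2) × (Matrix (Fin 2) (Fin 2) L2) × L2

/-- The Fourier coefficients of a state. -/
noncomputable def stateCoeff (X : State) (n : Fin 3 → ℤ) :
    (Idx → ℂ) × Matrix (Fin 2) (Fin 2) ℂ × ℂ :=
  (fun j => coeff (X.1 j) n, X.2.1.map (fun f => coeff f n), coeff X.2.2 n)

/-- The symbol of the linearized operator `𝓛 = 𝓑 ⊕ (τ/2κ) [R, ·] ⊕ 0`. -/
noncomputable def LHat (p : Params) (n : Fin 3 → ℤ)
    (y : (Idx → ℂ) × Matrix (Fin 2) (Fin 2) ℂ × ℂ) :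
    (Idx → ℂ) × Matrix (Fin 2) (Fin 2) ℂ × ℂ :=
  (p.BHat (intWave n) *ᵥ y.1,
    (p.d : ℂ) • (toC R22 * y.2.1 - y.2.1 * toC R22),
    0)

/-- Membership in the Sobolev space `H²` of the torus. -/
def IsH2 (f : L2) : Prop :=
  Summable (fun n : Fin 3 → ℤ => (1 + ‖intWave n‖ ^ 2) ^ 2 * ‖coeff f n‖ ^ 2)

/-- The domain of `𝓛`: `u` and `ω` are in `H²`, the other components in `L²`. -/
def InDomain (X : State) : Prop :=
  (∀ i : Fin 3, IsH2 (X.1 (Sum.inl i))) ∧ (∀ i : Fin 3, IsH2 (X.1 (Sum.inr (Sum.inl i))))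

/-- `W = 𝓛 X`. -/
def IsImage (p : Params) (X W : State) : Prop :=
  InDomain X ∧ ∀ n, stateCoeff W n = LHat p n (stateCoeff X n)

/-- `w` is an eigenvalue of the linearized operator `𝓛` on (the complexification of) `L²`. -/
def IsEigenvalueLin (p : Params) (w : ℂ) : Prop :=
  ∃ X : State, X ≠ 0 ∧ IsImage p X (w • X)

end Micropolar

namespace Micropolar

/-! At high frequency the viscous terms are of order `|k|²` and damp `u` and `ω`, but nothing damps
`a`. To leading order `a` rotates under `d R₂₂`, with eigenvalues `±i d` and eigenvectors `(1, ∓i)`.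
The velocity is eliminated exactly, and so is the `(1, i)` component of `a`. The angular velocity is
then slaved to `a`, of size `|k|⁻²`, and its feedback turns the eigenvalue equation into `w = i d +
|k|⁻² g`, where `g` is the correction. As `|k| → ∞`, `g` tends to `(λ - ν) d² / 2` times the
Hermitian form of `(α̃ P_∥ + γ̃ P_⊥)⁻¹` at `(1, -i, 0)`. This is positive because `λ > ν`, so the
eigenvalue approaches `i d` from the right half plane.

To solve the equation uniformly in the direction of `k`, infinity is compactified: in the variables
`(|k|⁻², k/|k|)` it becomes `{0} × S²`. The implicit function theorem applies at each point of this
compact set, and compactness glues the local solutions (`exists_contDiffAt_fixedPoint`).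
`isEigenvalue_BHat_of_fixedPoint` converts solutions into eigenvectors of `B̂_k`, and
`reducedMatrix_of_mem_limitSet` gives the sign. The branch passes to `M(k)` because its values are
nonzero, and to `𝓛` by multiplying an eigenvector by a character. -/

open Filter Topology

/-! ### Fixed points near a compact set -/

/-- The fixed point equation `w = w₀ + e y * g (y, w)`, where `e` vanishes on a compact set `K`, has
a solution `z y` close to `w₀` for `y` near `K`, and it depends on `y` in a `C¹` way. -/
theorem exists_contDiffAt_fixedPoint {X : Type*} [NormedAddCommGroup X] [NormedSpace ℝ X]
    [CompleteSpace X] {K : Set X} (hK : IsCompact K) {w₀ : ℂ} {e : X → ℂ} {g : X × ℂ → ℂ}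
    (he : ContDiff ℝ 1 e) (he0 : ∀ x ∈ K, e x = 0) (hg : ∀ x ∈ K, ContDiffAt ℝ 1 g (x, w₀)) :
    ∃ z : X → ℂ, ∀ x ∈ K, z x = w₀ ∧ ContDiffAt ℝ 1 z x ∧
      ∀ᶠ y in 𝓝 x, z y = w₀ + e y * g (y, z y) := by
  set H : X × ℂ → ℂ := fun v => v.2 - w₀ - e v.1 * g v with hHdef
  have hH : ∀ x ∈ K, ContDiffAt ℝ 1 H (x, w₀) := fun x hx =>
    (contDiffAt_snd.sub contDiffAt_const).sub ((he.comp contDiff_fst).contDiffAt.mul (hg x hx))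
  have hH0 : ∀ x ∈ K, H (x, w₀) = 0 := fun x hx => by simp [H, he0 x hx]
  have loc : ∀ x ∈ K, ∃ ψ : X → ℂ, ψ x = w₀ ∧ ContDiffAt ℝ 1 ψ x ∧
      ∀ᶠ v in 𝓝 (x, w₀), H v = 0 ↔ ψ v.1 = v.2 := by
    intro x hx
    -- On `K` the factor `e` vanishes, so the partial derivative of `H` in `w` is the identity
    -- there.
    have hinv : (fderiv ℝ H (x, w₀) ∘L .inr ℝ X ℂ).IsInvertible := by
      have h1 : HasFDerivAt (fun w : ℂ => H (x, w)) (fderiv ℝ H (x, w₀) ∘L .inr ℝ X ℂ) w₀ :=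
        HasFDerivAt.comp (g := H) w₀ (((hH x hx).differentiableAt one_ne_zero).hasFDerivAt)
          (hasFDerivAt_prodMk_right x w₀)
      have h2 : HasFDerivAt (fun w : ℂ => H (x, w)) (ContinuousLinearMap.id ℝ ℂ) w₀ := by
        have : (fun w : ℂ => H (x, w)) = fun w => w - w₀ := by
          funext w; simp [H, he0 x hx]
        rw [this]
        exact (hasFDerivAt_id w₀).sub_const w₀
      rw [h1.unique h2]
      exact ⟨ContinuousLinearEquiv.refl ℝ ℂ, rfl⟩
    refine ⟨(hH x hx).implicitFunction one_ne_zero hinv,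
      (hH x hx).implicitFunction_apply_self one_ne_zero hinv,
      (hH x hx).contDiffAt_implicitFunction one_ne_zero hinv, ?_⟩
    have := (hH x hx).eventually_apply_eq_iff_implicitFunction one_ne_zero hinv
    rwa [hH0 x hx] at this
  choose! ψ hψ using loc
  -- Local uniqueness of zeros, made uniform along `K` by the tube lemma; this is what lets the
  -- local implicit functions agree with one global choice.
  have huniq : ∀ᶠ q in 𝓝ˢ K ×ˢ 𝓝 (w₀, w₀),
      H (q.1, q.2.1) = 0 → H (q.1, q.2.2) = 0 → q.2.1 = q.2.2 := by
    rw [← nhdsSet_singleton, ← hK.nhdsSet_prod_eq isCompact_singleton]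
    refine eventually_nhdsSet_iff_forall.2 ?_
    rintro ⟨x, w⟩ ⟨hx, hw⟩
    obtain rfl : w = (w₀, w₀) := hw
    have t1 : Tendsto (fun q : X × ℂ × ℂ => (q.1, q.2.1)) (𝓝 (x, w₀, w₀)) (𝓝 (x, w₀)) :=
      Continuous.tendsto (by fun_prop) (x, w₀, w₀)
    have t2 : Tendsto (fun q : X × ℂ × ℂ => (q.1, q.2.2)) (𝓝 (x, w₀, w₀)) (𝓝 (x, w₀)) :=
      Continuous.tendsto (by fun_prop) (x, w₀, w₀)
    filter_upwards [t1.eventually (hψ x hx).2.2, t2.eventually (hψ x hx).2.2] with q h1 h2 h3 h4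
    exact (h1.1 h3).symm.trans (h2.1 h4)
  obtain ⟨V, hV, W', hW', hVW⟩ := eventually_prod_iff.1 huniq
  rw [nhds_prod_eq] at hW'
  obtain ⟨W, hW, hWW⟩ := mem_prod_self_iff.1 hW'
  classical
  -- The default `w₀` is never used near `K`, where a zero in `W` exists.
  refine ⟨fun y => if h : ∃ w ∈ W, H (y, w) = 0 then h.choose else w₀, fun x hx => ?_⟩
  set z : X → ℂ := fun y => if h : ∃ w ∈ W, H (y, w) = 0 then h.choose else w₀ with hz
  have hcont : ContinuousAt (ψ x) x := (hψ x hx).2.1.continuousAt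
  have hW2 : ∀ᶠ y in 𝓝 x, ψ x y ∈ W :=
    hcont.eventually (by rw [(hψ x hx).1]; exact hW)
  have hzero : ∀ᶠ y in 𝓝 x, H (y, ψ x y) = 0 := by
    have t : Tendsto (fun y => (y, ψ x y)) (𝓝 x) (𝓝 (x, w₀)) := by
      have := (continuousAt_id (x := x)).prodMk hcont
      simpa [ContinuousAt, (hψ x hx).1] using this
    filter_upwards [t.eventually (hψ x hx).2.2] with y hy using hy.2 rfl
  have heq : z =ᶠ[𝓝 x] ψ x := by
    filter_upwards [hW2, hzero, hV.filter_mono (nhds_le_nhdsSet hx)] with y h1 h2 h3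
    have hex : ∃ w ∈ W, H (y, w) = 0 := ⟨_, h1, h2⟩
    have : z y = hex.choose := by simp only [hz]; exact dif_pos hex
    rw [this]
    exact hVW h3 (hWW (Set.mk_mem_prod hex.choose_spec.1 h1)) hex.choose_spec.2 h2
  refine ⟨heq.eq_of_nhds.trans (hψ x hx).1, (hψ x hx).2.1.congr_of_eventuallyEq heq, ?_⟩
  filter_upwards [hzero, heq] with y h1 h2
  rw [h2]
  linear_combination h1


/-! ### Characters of the torus and eigenvalues of `𝓛` -/

open MeasureTheory

instance : IsProbabilityMeasure haar := by unfold haar; infer_instance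

/-- The character `x ↦ e^{i n·x}` of the torus, as a continuous map. -/
noncomputable def character (n : Fin 3 → ℤ) : C(Torus, ℂ) :=
  ⟨fun x => ∏ i, fourier (n i) (x i), by fun_prop⟩

/-- The character `x ↦ e^{i n·x}` of the torus, as a square integrable function. -/
noncomputable def characterLp (n : Fin 3 → ℤ) : L2 :=
  ContinuousMap.toLp 2 haar ℂ (character n)

theorem integral_fourier_haarAddCircle (m : ℤ) :
    ∫ x : AddCircle (2 * Real.pi), fourier m x ∂AddCircle.haarAddCircle
      = if m = 0 then 1 else 0 := by
  have h := (orthonormal_iff_ite.1 (orthonormal_fourier (T := 2 * Real.pi))) 0 m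
  rw [ContinuousMap.inner_toLp] at h
  simpa [eq_comm] using h

/-- Orthogonality of characters: the integral factors over the three circles, and a coordinate where
`n` and `m` differ contributes a factor zero. -/
theorem coeff_smul_characterLp (c : ℂ) (m n : Fin 3 → ℤ) :
    coeff (c • characterLp m) n = if n = m then c else 0 := by
  have hae : (fun x : Torus => (∏ i, fourier (-(n i)) (x i)) * (c • characterLp m : L2) x)
      =ᵐ[haar] fun x => c * ∏ i, fourier (m i - n i) (x i) := by
    filter_upwards [Lp.coeFn_smul c (characterLp m),
      ContinuousMap.coeFn_toLp (p := 2) (𝕜 := ℂ) haar (character m)] with x h1 h2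
    rw [h1, Pi.smul_apply, characterLp, h2, smul_eq_mul, mul_left_comm]
    congr 1
    simp only [character, ContinuousMap.coe_mk]
    rw [← Finset.prod_mul_distrib]
    refine Finset.prod_congr rfl fun i _ => ?_
    rw [← fourier_add]
    congr 2
    ring
  rw [coeff, integral_congr_ae hae, integral_const_mul, haar,
    integral_fintype_prod_eq_prod (fun i (x : AddCircle (2 * Real.pi)) => fourier (m i - n i) x)]
  simp only [integral_fourier_haarAddCircle]
  by_cases h : n = m
  · simp [h]
  · obtain ⟨i, hi⟩ := Function.ne_iff.1 h
    rw [if_neg h, Finset.prod_eq_zero (Finset.mem_univ i), mul_zero]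
    rw [if_neg]
    intro h'
    exact hi (by linarith)

theorem coeff_zero (n : Fin 3 → ℤ) : coeff 0 n = 0 := by
  simpa using coeff_smul_characterLp 0 0 n

/-- An eigenvalue of the symbol at an integer wavenumber is an eigenvalue of the operator. -/
theorem isEigenvalueLin_of_isEigenvalue (p : Params) {n : Fin 3 → ℤ} {w : ℂ}
    (h : IsEigenvalue (p.BHat (intWave n)) w) : IsEigenvalueLin p w := by
  obtain ⟨x, hx⟩ := h.exists_hasEigenvector
  have hxe : p.BHat (intWave n) *ᵥ x = w • x := by
    simpa using hx.apply_eq_smul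
  have hH2 : ∀ j, IsH2 (x j • characterLp n) := by
    intro j
    refine summable_of_ne_finset_zero (s := {n}) fun m hm => ?_
    rw [coeff_smul_characterLp, if_neg (by simpa using hm)]
    simp
  refine ⟨(fun j => x j • characterLp n, 0, 0), ?_, ⟨fun i => hH2 _, fun i => hH2 _⟩, fun m => ?_⟩
  · intro h0
    refine hx.2 (funext fun j => ?_)
    have h1 : x j • characterLp n = 0 := congrFun (congrArg Prod.fst h0) j
    have h2 := coeff_smul_characterLp (x j) n n
    rw [h1, coeff_zero, if_pos rfl] at h2
    exact h2.symm
  · have key : (fun j => coeff (x j • characterLp n) m) = (if m = n then (1 : ℂ) else 0) • x := by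
      funext j
      rw [coeff_smul_characterLp]
      split_ifs <;> simp
    have key' : (fun j => coeff (w • x j • characterLp n) m)
        = (if m = n then (1 : ℂ) else 0) • (w • x) := by
      funext j
      rw [smul_smul, coeff_smul_characterLp]
      split_ifs <;> simp
    refine Prod.ext ?_ (Prod.ext ?_ ?_)
    · change (fun j => coeff (w • x j • characterLp n) m)
        = p.BHat (intWave m) *ᵥ fun j => coeff (x j • characterLp n) m
      rw [key, key']
      split_ifs with hm
      · rw [hm, one_smul, one_smul, hxe]
      · simp
    · have hz : (0 : Matrix (Fin 2) (Fin 2) L2).map (fun f => coeff f m) = 0 := by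
        ext i j; simp [coeff_zero]
      simp only [stateCoeff, LHat, Prod.smul_mk, smul_zero, hz]
      simp
    · simp [stateCoeff, LHat, coeff_zero]


/-! ### The action of the symbol and elimination of the velocity -/

open Complex

theorem isEigenvalue_of_mulVec {A : Matrix Idx Idx ℂ} {w : ℂ} {x : Idx → ℂ} (hx : x ≠ 0)
    (h : A *ᵥ x = w • x) : IsEigenvalue A w :=
  Module.End.hasEigenvalue_of_hasEigenvector
    (Module.End.hasEigenvector_iff.2 ⟨Module.End.mem_eigenspace_iff.2 (by simpa using h), hx⟩)

theorem IsEigenvalue.exists_mulVec {A : Matrix Idx Idx ℂ} {w : ℂ} (h : IsEigenvalue A w) :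
    ∃ x : Idx → ℂ, x ≠ 0 ∧ A *ᵥ x = w • x := by
  obtain ⟨x, hx⟩ := h.exists_hasEigenvector
  exact ⟨x, hx.2, by simpa using hx.apply_eq_smul⟩

theorem blocks_mulVec (A₁₁ A₁₂ : Matrix (Fin 3) (Fin 3) ℂ) (A₁₃ : Matrix (Fin 3) (Fin 2) ℂ)
    (A₂₁ A₂₂ : Matrix (Fin 3) (Fin 3) ℂ) (A₂₃ : Matrix (Fin 3) (Fin 2) ℂ)
    (A₃₁ A₃₂ : Matrix (Fin 2) (Fin 3) ℂ) (A₃₃ : Matrix (Fin 2) (Fin 2) ℂ)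
    (u ω : Fin 3 → ℂ) (a : Fin 2 → ℂ) :
    blocks A₁₁ A₁₂ A₁₃ A₂₁ A₂₂ A₂₃ A₃₁ A₃₂ A₃₃ *ᵥ Sum.elim u (Sum.elim ω a) =
      Sum.elim (A₁₁ *ᵥ u + (A₁₂ *ᵥ ω + A₁₃ *ᵥ a)) (Sum.elim (A₂₁ *ᵥ u + (A₂₂ *ᵥ ω + A₂₃ *ᵥ a))
        (A₃₁ *ᵥ u + (A₃₂ *ᵥ ω + A₃₃ *ᵥ a))) := by
  rw [blocks, Matrix.fromBlocks_mulVec]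
  ext (i | i | i) <;>
    simp only [Matrix.fromRows_mulVec, Matrix.fromCols_mulVec, Matrix.fromBlocks_mulVec,
      Sum.elim_inl, Sum.elim_inr, Sum.elim_comp_inl, Sum.elim_comp_inr, Pi.add_apply]

theorem norm_sq_wave (k : Wave) : ‖k‖ ^ 2 = k 0 ^ 2 + k 1 ^ 2 + k 2 ^ 2 := by
  rw [EuclideanSpace.real_norm_sq_eq, Fin.sum_univ_three]

theorem toC_sub {m n : Type} (A B : Matrix m n ℝ) : toC (A - B) = toC A - toC B := by
  ext; simp [toC]

theorem toC_smul {m n : Type} (c : ℝ) (A : Matrix m n ℝ) : toC (c • A) = (c : ℂ) • toC A := by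
  ext; simp [toC]

theorem toC_mul {l m n : Type} [Fintype m] (A : Matrix l m ℝ) (B : Matrix m n ℝ) :
    toC (A * B) = toC A * toC B := by
  ext; simp [toC, Matrix.mul_apply]

theorem toC_one {m : Type} [DecidableEq m] : toC (1 : Matrix m m ℝ) = 1 := by
  ext i j; by_cases h : i = j <;> simp [toC, Matrix.one_apply, h]

theorem toC_diagonal_mulVec {m : Type} [Fintype m] [DecidableEq m] (d : m → ℝ) (v : m → ℂ) :
    toC (Matrix.diagonal d) *ᵥ v = fun i => d i * v i := by
  ext i
  rw [toC, Matrix.diagonal_map (by simp), Matrix.mulVec_diagonal]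

theorem toC_cross_mulVec (k : Wave) (v : Fin 3 → ℂ) : toC (cross k) *ᵥ v =
    ![k 1 * v 2 - k 2 * v 1, k 2 * v 0 - k 0 * v 2, k 0 * v 1 - k 1 * v 0] := by
  ext i
  fin_cases i <;>
    simp [toC, cross, Matrix.mulVec, dotProduct, Fin.sum_univ_three] <;> ring

theorem toC_Ppar_mulVec (k : Wave) (v : Fin 3 → ℂ) : toC (Ppar k) *ᵥ v =
    fun i => ((‖k‖ : ℂ) ^ 2)⁻¹ * (k i * (k 0 * v 0 + k 1 * v 1 + k 2 * v 2)) := by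
  ext i
  simp only [Matrix.mulVec, dotProduct, Fin.sum_univ_three, toC, Matrix.map_apply, Ppar,
    Matrix.smul_apply, Matrix.vecMulVec_apply, smul_eq_mul]
  push_cast
  ring

theorem toC_R22_mulVec (v : Fin 2 → ℂ) : toC R22 *ᵥ v = ![-v 1, v 0] := by
  ext i; fin_cases i <;> simp [toC, R22, Matrix.mulVec, dotProduct]

theorem toC_R23_mulVec (v : Fin 3 → ℂ) : toC R23 *ᵥ v = ![-v 1, v 0] := by
  ext i; fin_cases i <;> simp [toC, R23, Matrix.mulVec, dotProduct, Fin.sum_univ_three]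

theorem toC_R32_mulVec (v : Fin 2 → ℂ) : toC R32 *ᵥ v = ![-v 1, v 0, 0] := by
  ext i; fin_cases i <;> simp [toC, R32, Matrix.mulVec, dotProduct]

theorem toC_R33_mulVec (v : Fin 3 → ℂ) : toC R33 *ᵥ v = ![-v 1, v 0, 0] := by
  ext i; fin_cases i <;> simp [toC, R33, Matrix.mulVec, dotProduct, Fin.sum_univ_three]

/-- The eigenvalue equation of `B̂_k` after elimination of the velocity. -/
theorem isEigenvalue_BHat_of_reduced (p : Params) {k : Wave} (hk : k ≠ 0) {w c : ℂ}
    (hc : c * (w + (p.μ + p.κ / 2) * (‖k‖ : ℂ) ^ 2) = p.κ) {ω : Fin 3 → ℂ} {a : Fin 2 → ℂ}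
    (ha : a ≠ 0)
    (hω : ∀ i, w * ω i = (![p.lam⁻¹, p.lam⁻¹, p.nu⁻¹] i : ℝ) *
      ((p.κ * c - (p.β + p.γ)) * ((‖k‖ : ℂ) ^ 2 * ω i
          - k i * (k 0 * ω 0 + k 1 * ω 1 + k 2 * ω 2))
        - 2 * p.κ * ω i
        - (p.α + 4 * p.β / 3) * k i * (k 0 * ω 0 + k 1 * ω 1 + k 2 * ω 2))
      - (1 - p.nu / p.lam) * p.d * ![-ω 1, ω 0, 0] i
      - (p.lam : ℂ)⁻¹ * p.d ^ 2 * ![-a 1, a 0, 0] i)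
    (ha0 : w * a 0 = -(p.lam - p.nu) * ω 1 - p.d * a 1)
    (ha1 : w * a 1 = (p.lam - p.nu) * ω 0 + p.d * a 0) :
    IsEigenvalue (p.BHat k) w := by
  set v : Fin 3 → ℂ :=
    ![k 1 * ω 2 - k 2 * ω 1, k 2 * ω 0 - k 0 * ω 2, k 0 * ω 1 - k 1 * ω 0] with hv
  have hN : (‖k‖ : ℂ) ^ 2 = (k 0 : ℂ) ^ 2 + (k 1 : ℂ) ^ 2 + (k 2 : ℂ) ^ 2 := by
    exact_mod_cast norm_sq_wave k
  have hN0 : (‖k‖ : ℂ) ^ 2 ≠ 0 := by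
    simpa using hk
  have hcross : toC (cross k) *ᵥ ω = v := toC_cross_mulVec k ω
  have hPar : toC (Ppar k) *ᵥ v = 0 := by
    rw [toC_Ppar_mulVec]
    ext i
    simp [hv]
    right; right; ring
  have hcc : ∀ i, (toC (cross k) *ᵥ v) i =
      -((‖k‖ : ℂ) ^ 2 * ω i - k i * (k 0 * ω 0 + k 1 * ω 1 + k 2 * ω 2)) := by
    intro i
    rw [toC_cross_mulVec, hN]
    fin_cases i <;> simp [hv] <;> ring
  -- The first block row reads `(w + (μ + κ/2)|k|²) u = iκ k × ω` for `u ⊥ k`, which forces `u = i c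
  -- k × ω`.
  refine isEigenvalue_of_mulVec (x := Sum.elim ((I * c) • v) (Sum.elim ω a)) ?_ ?_
  · intro h
    exact ha (funext fun i => congrFun h (Sum.inr (Sum.inr i)))
  · rw [Params.BHat, blocks_mulVec]
    simp only [Pperp, Params.JInv, toC_sub, toC_smul, toC_mul, toC_one, Matrix.smul_mulVec,
      Matrix.mulVec_smul, Matrix.sub_mulVec, ← Matrix.mulVec_mulVec, Matrix.one_mulVec,
      toC_diagonal_mulVec, hcross, hPar, sub_zero, Matrix.zero_mulVec, add_zero,
      toC_R33_mulVec, toC_R32_mulVec, toC_R23_mulVec, toC_R22_mulVec, toC_Ppar_mulVec, hcc]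
    push_cast
    generalize (‖k‖ : ℂ) ^ 2 = N at *
    ext (i | i | i)
    · simp
      linear_combination (-I * v i) * hc
    · have h := hω i
      simp only [Sum.elim_inr, Sum.elim_inl, Pi.smul_apply, Pi.add_apply, Pi.sub_apply,
        smul_eq_mul]
      linear_combination -h
        - (c * p.κ * (![p.lam⁻¹, p.lam⁻¹, p.nu⁻¹] i : ℝ) *
            (N * ω i - k i * (k 0 * ω 0 + k 1 * ω 1 + k 2 * ω 2))) * I_mul_I
        + (((p.β + p.γ) - (p.α + 4 * p.β / 3)) * (![p.lam⁻¹, p.lam⁻¹, p.nu⁻¹] i : ℝ) *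
            (k i * (k 0 * ω 0 + k 1 * ω 1 + k 2 * ω 2))) * mul_inv_cancel₀ hN0
    · fin_cases i
      · simp
        linear_combination -ha0
      · simp
        linear_combination -ha1


/-! ### Conjugation symmetry and passage to `M(k)` -/

theorem star_toC_mulVec {m n : Type} [Fintype n] (A : Matrix m n ℝ) (v : n → ℂ) :
    star (toC A *ᵥ v) = toC A *ᵥ star v := by
  ext i
  simp [Matrix.mulVec, dotProduct, toC]

theorem exists_eq_sumElim (x : Idx → ℂ) :
    ∃ u ω a, x = Sum.elim u (Sum.elim ω a) :=
  ⟨fun i => x (Sum.inl i), fun i => x (Sum.inr (Sum.inl i)), fun i => x (Sum.inr (Sum.inr i)), by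
    ext (i | i | i) <;> rfl⟩

theorem sumElim_eq_smul_iff {u u' ω ω' : Fin 3 → ℂ} {a a' : Fin 2 → ℂ} {w : ℂ} :
    Sum.elim u (Sum.elim ω a) = w • (Sum.elim u' (Sum.elim ω' a') : Idx → ℂ) ↔
      u = w • u' ∧ ω = w • ω' ∧ a = w • a' := by
  constructor
  · intro h
    exact ⟨funext fun i => congrFun h (Sum.inl i), funext fun i => congrFun h (Sum.inr (Sum.inl i)),
      funext fun i => congrFun h (Sum.inr (Sum.inr i))⟩
  · rintro ⟨rfl, rfl, rfl⟩
    ext (i | i | i) <;> rfl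

/-- The spectrum of `B̂_k` is invariant under complex conjugation. -/
theorem IsEigenvalue.BHat_conj {p : Params} {k : Wave} {w : ℂ} (h : IsEigenvalue (p.BHat k) w) :
    IsEigenvalue (p.BHat k) (starRingEnd ℂ w) := by
  obtain ⟨x, hx0, hx⟩ := h.exists_mulVec
  obtain ⟨u, ω, a, rfl⟩ := exists_eq_sumElim x
  -- Conjugation changes the sign of the two blocks `iκ k×` coupling `u` and `ω`; flipping the sign
  -- of `u` restores them.
  refine isEigenvalue_of_mulVec (x := Sum.elim (-star u) (Sum.elim (star ω) (star a))) ?_ ?_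
  · intro h0
    refine hx0 ?_
    ext (i | i | i)
    · simpa using congrFun h0 (Sum.inl i)
    · simpa using congrFun h0 (Sum.inr (Sum.inl i))
    · simpa using congrFun h0 (Sum.inr (Sum.inr i))
  · rw [Params.BHat, blocks_mulVec, sumElim_eq_smul_iff] at hx ⊢
    obtain ⟨h1, h2, h3⟩ := hx
    replace h1 := congrArg star h1
    replace h2 := congrArg star h2
    replace h3 := congrArg star h3
    simp only [star_add, Matrix.smul_mulVec, star_smul, star_toC_mulVec, Matrix.zero_mulVec,
      add_zero, zero_add, Matrix.mulVec_neg] at h1 h2 h3 ⊢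
    have hI : star I = -I := conj_I
    rw [hI] at h1 h2
    refine ⟨?_, ?_, ?_⟩
    · rw [starRingEnd_apply, smul_neg, ← h1]
      simp [add_comm]
    · rw [starRingEnd_apply, ← h2]
      simp
    · rw [starRingEnd_apply, ← h3]
      simp

/-- For `u ⊥ k` one has `k × (k × u) = -|k|² u`, and the sign is absorbed by `i²`. -/
theorem T_mulVec_T_mulVec {k : Wave} (hk : k ≠ 0) {u : Fin 3 → ℂ}
    (hu : k 0 * u 0 + k 1 * u 1 + k 2 * u 2 = 0) :
    Params.T k *ᵥ (Params.T k *ᵥ u) = u := by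
  have hN : (‖k‖ : ℂ) ^ 2 = (k 0 : ℂ) ^ 2 + (k 1 : ℂ) ^ 2 + (k 2 : ℂ) ^ 2 := by
    exact_mod_cast norm_sq_wave k
  have hN0 : (‖k‖ : ℂ) ≠ 0 := by simpa using hk
  have hcc : toC (cross k) *ᵥ (toC (cross k) *ᵥ u) = -((‖k‖ : ℂ) ^ 2 • u) := by
    rw [toC_cross_mulVec, toC_cross_mulVec, hN]
    ext i
    fin_cases i
    · simp; linear_combination (k 0 : ℂ) * hu
    · simp; linear_combination (k 1 : ℂ) * hu
    · simp; linear_combination (k 2 : ℂ) * hu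
  simp only [Params.T, toC_smul, Matrix.smul_mulVec, Matrix.mulVec_smul, hcc, smul_neg, smul_smul]
  rw [← neg_smul]
  convert one_smul ℂ u using 2
  push_cast
  field_simp
  simp

/-- A nonzero eigenvalue of `B̂_k` is an eigenvalue of `M(k)`. -/
theorem IsEigenvalue.M_of_BHat {p : Params} (hp : p.Admissible) {k : Wave} (hk : k ≠ 0) {w : ℂ}
    (hw : w ≠ 0) (h : IsEigenvalue (p.BHat k) w) : IsEigenvalue (p.M k) w := by
  obtain ⟨x, hx0, hx⟩ := h.exists_mulVec
  have hQ : p.QBar k *ᵥ (p.Q k *ᵥ x) = x := by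
    obtain ⟨u, ω, a, rfl⟩ := exists_eq_sumElim x
    have hu : k 0 * u 0 + k 1 * u 1 + k 2 * u 2 = 0 := by
      rw [Params.BHat, blocks_mulVec, sumElim_eq_smul_iff] at hx
      have hN : (‖k‖ : ℂ) ^ 2 = (k 0 : ℂ) ^ 2 + (k 1 : ℂ) ^ 2 + (k 2 : ℂ) ^ 2 := by
        exact_mod_cast norm_sq_wave k
      have hN0 : (‖k‖ : ℂ) ^ 2 ≠ 0 := by simpa using hk
      have h1 := hx.1
      simp only [Pperp, toC_smul, toC_sub, toC_one, Matrix.smul_mulVec, Matrix.sub_mulVec,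
        Matrix.one_mulVec, toC_cross_mulVec, toC_Ppar_mulVec, Matrix.zero_mulVec, add_zero] at h1
      have e0 := congrFun h1 0
      have e1 := congrFun h1 1
      have e2 := congrFun h1 2
      simp at e0 e1 e2
      -- Pairing the first block row with `k` kills its right-hand side, so `w (k · u) = 0`.
      refine (mul_eq_zero.1 (?_ : w * _ = 0)).resolve_left hw
      generalize (‖k‖ : ℂ) ^ 2 = N at *
      linear_combination -(k 0 : ℂ) * e0 - (k 1 : ℂ) * e1 - (k 2 : ℂ) * e2
        - (p.μ + p.κ / 2) * (k 0 * u 0 + k 1 * u 1 + k 2 * u 2) * N * N⁻¹ * hN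
        + (p.μ + p.κ / 2) * (k 0 * u 0 + k 1 * u 1 + k 2 * u 2) * N * mul_inv_cancel₀ hN0
    have hlam : 0 < p.lam := hp.nu_pos.trans hp.oblong
    have h1 : (√p.lam : ℂ) ≠ 0 := by
      exact_mod_cast (Real.sqrt_pos.2 hlam).ne'
    have h2 : (√p.nu : ℂ) ≠ 0 := by
      exact_mod_cast (Real.sqrt_pos.2 hp.nu_pos).ne'
    have hs : (p.s : ℂ) ≠ 0 := by
      have : 0 < √(p.lam - p.nu) := Real.sqrt_pos.2 (sub_pos.2 hp.oblong)
      have hκ := hp.κ_pos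
      have hτ := hp.τ_pos
      have : p.s ≠ 0 := by
        unfold Params.s Params.d
        refine mul_ne_zero (div_ne_zero (by norm_num) this.ne') (by positivity)
      exact_mod_cast this
    rw [Params.Q, Params.QBar, blocks_mulVec, blocks_mulVec]
    simp only [Matrix.zero_mulVec, add_zero, zero_add, T_mulVec_T_mulVec hk hu, toC_smul,
      Params.JSqrt, Params.JInvSqrt, toC_diagonal_mulVec, Matrix.smul_mulVec, Matrix.mulVec_smul,
      toC_R22_mulVec]
    refine congrArg₂ _ (by simp) (congrArg₂ _ (funext fun i => ?_) (funext fun i => ?_))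
    · fin_cases i <;> simp <;> field_simp
    · fin_cases i <;> simp <;> field_simp
  refine isEigenvalue_of_mulVec (x := p.Q k *ᵥ x) ?_ ?_
  · intro h0
    rw [h0, Matrix.mulVec_zero] at hQ
    exact hx0 hQ.symm
  · rw [Params.M, ← Matrix.mulVec_mulVec, ← Matrix.mulVec_mulVec, hQ, hx, Matrix.mulVec_smul]


/-! ### The reduced `3 × 3` problem -/

/-- The eigenvector `(1, -i)` of `R₂₂` for the eigenvalue `i`, embedded in `ℂ³`. -/
def vPlus : Fin 3 → ℂ := ![1, -I, 0]

/-- The eigenvector `(1, i)` of `R₂₂` for the eigenvalue `-i`, embedded in `ℂ³`. -/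
def vMinus : Fin 3 → ℂ := ![1, I, 0]

namespace Params

/-- The equation satisfied by the angular velocity of an eigenvector with eigenvalue `w` at the
wavenumber `k`, after elimination of the velocity and of the `(1, i)` component of `a`, divided by
`|k|²`. The arguments are `((|k|⁻², k / |k|), w)`. -/
noncomputable def reducedMatrix (p : Params) (v : (ℝ × Wave) × ℂ) : Matrix (Fin 3) (Fin 3) ℂ :=
  Matrix.of fun i j =>
    (v.1.1 : ℂ) * (v.2 * (![p.lam, p.lam, p.nu] i : ℝ) + 2 * p.κ) * (if i = j then 1 else 0)
    + (p.α + 4 * p.β / 3) * ((v.1.2 i : ℂ) * (v.1.2 j : ℂ))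
    + (p.β + p.γ - p.κ * (p.κ * v.1.1 / (v.1.1 * v.2 + (p.μ + p.κ / 2)))) *
      ((if i = j then 1 else 0) - (v.1.2 i : ℂ) * (v.1.2 j : ℂ))
    + v.1.1 * ((p.lam - p.nu) * p.d * (R33 i j : ℂ))
    - v.1.1 * ((p.lam - p.nu) * p.d ^ 2 / (2 * (v.2 + I * p.d))) * (vMinus i * vPlus j)

/-- The correction term in the eigenvalue equation `w = i d + |k|⁻² g`. -/
noncomputable def correction (p : Params) (v : (ℝ × Wave) × ℂ) : ℂ :=
  (p.lam - p.nu) * p.d ^ 2 / 2 * (vMinus ⬝ᵥ ((p.reducedMatrix v)⁻¹ *ᵥ vPlus))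

end Params

/-- Normalize `a = (1, -i) + b (1, i)`. The `(1, i)` component of the equation for `a` determines
`b`; substituting it in the equation for `ω` gives a linear system with matrix `reducedMatrix` and
source proportional to `vPlus`. The remaining `(1, -i)` component is exactly the fixed point
equation. -/
theorem isEigenvalue_BHat_of_fixedPoint {p : Params} (hp : p.Admissible) {k : Wave} (hk : k ≠ 0)
    {w : ℂ} {y : ℝ × Wave} (hy : y = ((‖k‖ ^ 2)⁻¹, ‖k‖⁻¹ • k))
    (hdet : (p.reducedMatrix (y, w)).det ≠ 0)
    (h1 : (y.1 : ℂ) * w + (p.μ + p.κ / 2) ≠ 0) (h2 : w + I * p.d ≠ 0)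
    (h : w = I * p.d + y.1 * p.correction (y, w)) : IsEigenvalue (p.BHat k) w := by
  set ε : ℂ := ((y.1 : ℝ) : ℂ) with hε
  set N : ℂ := (‖k‖ : ℂ) ^ 2 with hN
  have hN0 : N ≠ 0 := by simpa [hN] using hk
  have hεN : ε = N⁻¹ := by rw [hε, hy, hN]; push_cast; rfl
  have hNε : N * ε = 1 := by rw [hεN, mul_inv_cancel₀ hN0]
  have hnn : ∀ i j, (y.2 i : ℂ) * (y.2 j : ℂ) = ε * (k i * k j) := by
    intro i j
    rw [hεN, hN, hy]
    simp
    ring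
  set ω : Fin 3 → ℂ := (-I * p.d ^ 2 * ε) • ((p.reducedMatrix (y, w))⁻¹ *ᵥ vPlus) with hω
  have hAω : p.reducedMatrix (y, w) *ᵥ ω = (-I * p.d ^ 2 * ε) • vPlus := by
    rw [hω, Matrix.mulVec_smul, Matrix.mulVec_mulVec, Matrix.mul_nonsing_inv _ (Ne.isUnit hdet),
      Matrix.one_mulVec]
  have hw : w = I * p.d + (p.lam - p.nu) * I * (ω 0 + I * ω 1) / 2 := by
    have e : ω 0 + I * ω 1
        = (-I * p.d ^ 2 * ε) * (vMinus ⬝ᵥ ((p.reducedMatrix (y, w))⁻¹ *ᵥ vPlus)) := by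
      simp [hω, vMinus, dotProduct, Fin.sum_univ_three]
      ring
    rw [e]
    nth_rewrite 1 [h]
    rw [Params.correction]
    linear_combination ((p.lam - p.nu) * p.d ^ 2 * ε / 2 *
      (vMinus ⬝ᵥ ((p.reducedMatrix (y, w))⁻¹ *ᵥ vPlus))) * I_mul_I
  clear_value ω
  set b : ℂ := -I * (p.lam - p.nu) * (ω 0 - I * ω 1) / (2 * (w + I * p.d)) with hb
  set c : ℂ := p.κ * ε / (ε * w + (p.μ + p.κ / 2)) with hc
  have hbw : b * (w + I * p.d) = -I * (p.lam - p.nu) * (ω 0 - I * ω 1) / 2 := by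
    rw [hb]; field_simp
  have hIb : (p.lam - p.nu) * p.d ^ 2 / (2 * (w + I * p.d)) * (ω 0 - I * ω 1)
      = p.d ^ 2 * I * b := by
    rw [hb]; field_simp; rw [I_sq]; ring
  have hcN : c * (w + (p.μ + p.κ / 2) * N) = p.κ := by
    rw [hc, div_mul_eq_mul_div, div_eq_iff h1]
    linear_combination (p.κ * (p.μ + p.κ / 2) : ℂ) * hNε
  have E : ∀ i, (w * (![p.lam, p.lam, p.nu] i : ℝ) + 2 * p.κ) * ω i
      + (p.α + 4 * p.β / 3) * k i * (k 0 * ω 0 + k 1 * ω 1 + k 2 * ω 2)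
      + (p.β + p.γ - p.κ * c) * (N * ω i - k i * (k 0 * ω 0 + k 1 * ω 1 + k 2 * ω 2))
      + (p.lam - p.nu) * p.d * ![-ω 1, ω 0, 0] i
      - p.d ^ 2 * I * b * vMinus i + I * p.d ^ 2 * vPlus i = 0 := by
    intro i
    have e := congrFun hAω i
    simp only [Matrix.mulVec, dotProduct, Fin.sum_univ_three, Params.reducedMatrix, Matrix.of_apply,
      hnn, ← hε, ← hc, Pi.smul_apply, smul_eq_mul] at e
    have hε0 : ε ≠ 0 := right_ne_zero_of_mul_eq_one hNε
    refine (mul_eq_zero.1 (?_ : ε * _ = 0)).resolve_left hε0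
    generalize (p.lam - p.nu : ℂ) * p.d ^ 2 / (2 * (w + I * p.d)) = Z at *
    fin_cases i
    · simp [vPlus, vMinus, R33, -mul_eq_zero] at e ⊢
      linear_combination e + (p.β + p.γ - p.κ * c) * ω 0 * hNε + ε * hIb
    · simp [vPlus, vMinus, R33, -mul_eq_zero] at e ⊢
      linear_combination e + (p.β + p.γ - p.κ * c) * ω 1 * hNε + ε * I * hIb + ε * ω 1 * Z * I_mul_I
    · simp [vPlus, vMinus, R33, -mul_eq_zero] at e ⊢
      linear_combination e + (p.β + p.γ - p.κ * c) * ω 2 * hNε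
  clear_value b c
  have hlam : (p.lam : ℂ) ≠ 0 := by exact_mod_cast (hp.nu_pos.trans hp.oblong).ne'
  have hnu : (p.nu : ℂ) ≠ 0 := by exact_mod_cast hp.nu_pos.ne'
  refine isEigenvalue_BHat_of_reduced p hk (ω := ω) (a := ![1 + b, -I + I * b]) hcN ?_ ?_ ?_ ?_
  · intro ha
    have e0 : 1 + b = 0 := congrFun ha 0
    have e1 : -I + I * b = 0 := congrFun ha 1
    have : (2 : ℂ) = 0 := by linear_combination e0 + I * e1 + (1 - b) * I_mul_I
    norm_num at this
  · intro i
    have e := E i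
    fin_cases i
    · simp [vPlus, vMinus] at e ⊢
      rw [← hN]
      field_simp
      -- The factor 3 comes from clearing the denominator in `4β/3`.
      linear_combination 3 * e
    · simp [vPlus, vMinus] at e ⊢
      rw [← hN]
      field_simp
      linear_combination 3 * e + (3 * p.d ^ 2 * (b + 1)) * I_mul_I
    · simp [vPlus, vMinus] at e ⊢
      rw [← hN]
      field_simp
      linear_combination 3 * e
  · simp
    linear_combination hbw + hw + ((p.lam - p.nu) * ω 1) * I_mul_I
  · simp
    linear_combination I * hbw - I * hw - (p.d + b * p.d + (p.lam - p.nu) * ω 0) * I_mul_I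


/-! ### Regularity and sign of the correction -/

/-- Cramer's rule: the determinant and the adjugate are polynomial in the entries. -/
theorem contDiffAt_matrix_inv {E : Type*} [NormedAddCommGroup E] [NormedSpace ℝ E]
    {A : E → Matrix (Fin 3) (Fin 3) ℂ} {x : E}
    (hA : ∀ i j, ContDiffAt ℝ 1 (fun y => A y i j) x) (hdet : (A x).det ≠ 0) (i j : Fin 3) :
    ContDiffAt ℝ 1 (fun y => (A y)⁻¹ i j) x := by
  have hd : ContDiffAt ℝ 1 (fun y => (A y).det) x := by
    simp only [Matrix.det_fin_three]
    fun_prop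
  have ha : ContDiffAt ℝ 1 (fun y => (A y).adjugate i j) x := by
    simp only [Matrix.adjugate_fin_three]
    fin_cases i <;> fin_cases j <;> simp <;> fun_prop
  simp only [Matrix.inv_def, Ring.inverse_eq_inv', Matrix.smul_apply, smul_eq_mul]
  exact (hd.inv hdet).mul ha

@[fun_prop]
theorem contDiffAt_ofReal_comp {E : Type*} [NormedAddCommGroup E] [NormedSpace ℝ E]
    {n : WithTop ℕ∞} {f : E → ℝ} {x : E} (hf : ContDiffAt ℝ n f x) :
    ContDiffAt ℝ n (fun y => (f y : ℂ)) x :=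
  ofRealCLM.contDiff.contDiffAt.comp x hf

variable {p : Params}

theorem Params.Admissible.d_pos (hp : p.Admissible) : 0 < p.d :=
  div_pos hp.τ_pos (by linarith [hp.κ_pos])

/-- The parameters `((|k|⁻², k / |k|), w)` in the limit `|k| → ∞`. -/
def limitSet : Set (ℝ × Wave) := {0} ×ˢ Metric.sphere 0 1

theorem isCompact_limitSet : IsCompact limitSet :=
  isCompact_singleton.prod (isCompact_sphere 0 1)

theorem contDiffAt_reducedMatrix {v : (ℝ × Wave) × ℂ}
    (h1 : (v.1.1 : ℂ) * v.2 + (p.μ + p.κ / 2) ≠ 0) (h2 : v.2 + I * p.d ≠ 0) (i j : Fin 3) :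
    ContDiffAt ℝ 1 (fun v => p.reducedMatrix v i j) v := by
  simp only [Params.reducedMatrix, Matrix.of_apply]
  generalize (if i = j then (1 : ℂ) else 0) = δ
  have e1 : ContDiffAt ℝ 1 (fun v : (ℝ × Wave) × ℂ =>
      (p.κ * v.1.1 / (v.1.1 * v.2 + (p.μ + p.κ / 2)) : ℂ)) v := by
    simp only [div_eq_mul_inv _ (_ * _ + _)]
    exact ContDiffAt.mul (by fun_prop) (ContDiffAt.inv (by fun_prop) h1)
  have e2 : ContDiffAt ℝ 1 (fun v : (ℝ × Wave) × ℂ =>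
      ((p.lam - p.nu) * p.d ^ 2 / (2 * (v.2 + I * p.d)) : ℂ)) v := by
    simp only [div_eq_mul_inv _ ((2 : ℂ) * _)]
    exact contDiffAt_const.mul (ContDiffAt.inv (by fun_prop) (mul_ne_zero two_ne_zero h2))
  have hn : ∀ i, ContDiffAt ℝ 1 (fun v : (ℝ × Wave) × ℂ => (v.1.2 i : ℂ)) v := fun i => by
    fun_prop
  have hε : ContDiffAt ℝ 1 (fun v : (ℝ × Wave) × ℂ => (v.1.1 : ℂ)) v := by fun_prop
  have hw : ContDiffAt ℝ 1 (fun v : (ℝ × Wave) × ℂ => v.2) v := by fun_prop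
  have hc : ∀ c : ℂ, ContDiffAt ℝ 1 (fun _ : (ℝ × Wave) × ℂ => c) v := fun c => contDiffAt_const
  exact (((((hε.mul ((hw.mul (hc _)).add (hc _))).mul (hc _)).add
    ((hc _).mul ((hn i).mul (hn j)))).add
    (((hc _).sub ((hc _).mul e1)).mul ((hc _).sub ((hn i).mul (hn j))))).add
    (hε.mul (hc _))).sub ((hε.mul e2).mul (hc _))

/-- At `|k|⁻² = 0` only `α̃ P + γ̃ (1 - P)` survives, with `P` the projection onto `n`; it is
inverted by inverting the two coefficients. As `vMinus` is the conjugate of `vPlus`, the correction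
is `λ - ν > 0` times a positive quantity. -/
theorem reducedMatrix_of_mem_limitSet {y : ℝ × Wave} (hy : y ∈ limitSet) (hp : p.Admissible)
    (w : ℂ) : (p.reducedMatrix (y, w)).det ≠ 0 ∧ 0 < (p.correction (y, w)).re := by
  obtain ⟨ε, n⟩ := y
  obtain ⟨h0, hn⟩ := hy
  obtain rfl : ε = 0 := h0
  have hn1 : n 0 ^ 2 + n 1 ^ 2 + n 2 ^ 2 = 1 := by
    rw [← norm_sq_wave, mem_sphere_zero_iff_norm.1 hn, one_pow]
  have hnC : (n 0 : ℂ) ^ 2 + (n 1 : ℂ) ^ 2 + (n 2 : ℂ) ^ 2 = 1 := by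
    simpa using congrArg (fun x : ℝ => (x : ℂ)) hn1
  set P : Matrix (Fin 3) (Fin 3) ℂ := Matrix.vecMulVec (fun i => (n i : ℂ)) fun i => (n i : ℂ)
    with hP
  have hPP : P * P = P := by
    have hdot : (fun i => (n i : ℂ)) ⬝ᵥ (fun i => (n i : ℂ)) = 1 := by
      rw [dotProduct, Fin.sum_univ_three]
      linear_combination hnC
    rw [hP, Matrix.vecMulVec_mul_vecMulVec, hdot, one_smul]
  have hα : ((p.α + 4 * p.β / 3 : ℝ) : ℂ) ≠ 0 := by exact_mod_cast hp.α_pos.ne'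
  have hγ : ((p.β + p.γ : ℝ) : ℂ) ≠ 0 := by exact_mod_cast hp.γ_pos.ne'
  have hA : p.reducedMatrix ((0, n), w)
      = ((p.α + 4 * p.β / 3 : ℝ) : ℂ) • P + ((p.β + p.γ : ℝ) : ℂ) • (1 - P) := by
    ext i j
    simp [Params.reducedMatrix, hP, Matrix.vecMulVec_apply, Matrix.one_apply]
  have hmul : p.reducedMatrix ((0, n), w) *
      (((p.α + 4 * p.β / 3 : ℝ) : ℂ)⁻¹ • P + ((p.β + p.γ : ℝ) : ℂ)⁻¹ • (1 - P)) = 1 := by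
    rw [hA]
    simp only [add_mul, mul_add, smul_mul_smul_comm, mul_sub, sub_mul, hPP, mul_one, one_mul,
      sub_self, sub_zero, smul_zero, add_zero, zero_add, mul_inv_cancel₀ hα, mul_inv_cancel₀ hγ,
      one_smul]
    abel
  refine ⟨?_, ?_⟩
  · have := congrArg Matrix.det hmul
    rw [Matrix.det_mul, Matrix.det_one] at this
    exact left_ne_zero_of_mul_eq_one this
  · have hval : p.correction ((0, n), w) = (((p.lam - p.nu) * p.d ^ 2 / 2 *
        ((p.α + 4 * p.β / 3)⁻¹ * (n 0 ^ 2 + n 1 ^ 2)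
          + (p.β + p.γ)⁻¹ * (2 - (n 0 ^ 2 + n 1 ^ 2))) : ℝ) : ℂ) := by
      rw [Params.correction, Matrix.inv_eq_right_inv hmul]
      simp only [Matrix.mulVec, dotProduct, Fin.sum_univ_three, hP, Matrix.vecMulVec_apply,
        Matrix.add_apply, Matrix.smul_apply, Matrix.sub_apply, Matrix.one_apply, vPlus, vMinus,
        smul_eq_mul]
      push_cast
      generalize ((p.α : ℂ) + 4 * p.β / 3)⁻¹ = a
      generalize ((p.β : ℂ) + p.γ)⁻¹ = b
      simp [-mul_eq_mul_left_iff]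
      linear_combination ((p.lam - p.nu) * p.d ^ 2 / 2 * (-a * n 1 ^ 2 - b * (1 - n 1 ^ 2)) : ℂ)
        * I_mul_I
    rw [hval, ofReal_re]
    have := hp.d_pos
    have := hp.α_pos
    have := hp.γ_pos
    have h3 : 0 < p.lam - p.nu := sub_pos.2 hp.oblong
    have h4 : 0 < 2 - (n 0 ^ 2 + n 1 ^ 2) := by nlinarith [sq_nonneg (n 2)]
    positivity

theorem contDiffAt_correction {v : (ℝ × Wave) × ℂ}
    (h1 : (v.1.1 : ℂ) * v.2 + (p.μ + p.κ / 2) ≠ 0) (h2 : v.2 + I * p.d ≠ 0)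
    (h3 : (p.reducedMatrix v).det ≠ 0) : ContDiffAt ℝ 1 p.correction v := by
  have h := contDiffAt_matrix_inv (contDiffAt_reducedMatrix (p := p) h1 h2) h3
  have h' : ∀ i, ContDiffAt ℝ 1 (fun v => ((p.reducedMatrix v)⁻¹ *ᵥ vPlus) i) v := by
    intro i
    simp only [Matrix.mulVec, dotProduct]
    exact ContDiffAt.sum fun j _ => (h i j).mul contDiffAt_const
  exact contDiffAt_const.mul (ContDiffAt.sum fun i _ => contDiffAt_const.mul (h' i))

theorem continuousAt_det_reducedMatrix {v : (ℝ × Wave) × ℂ}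
    (h1 : (v.1.1 : ℂ) * v.2 + (p.μ + p.κ / 2) ≠ 0) (h2 : v.2 + I * p.d ≠ 0) :
    ContinuousAt (fun v => (p.reducedMatrix v).det) v := by
  have h := fun i j => (contDiffAt_reducedMatrix (p := p) h1 h2 i j).continuousAt
  simp only [Matrix.det_fin_three]
  fun_prop

/-! ### Compactification at infinity and the unstable branch -/

/-- The map `k ↦ (|k|⁻², k / |k|)`. -/
noncomputable def compactify (k : Wave) : ℝ × Wave := ((‖k‖ ^ 2)⁻¹, ‖k‖⁻¹ • k)

theorem tendsto_compactify : Tendsto compactify (Bornology.cobounded Wave) (𝓝ˢ limitSet) := by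
  rw [limitSet, isCompact_singleton.nhdsSet_prod_eq (isCompact_sphere 0 1), nhdsSet_singleton]
  refine Tendsto.prodMk ?_ ?_
  · exact tendsto_inv_atTop_zero.comp
      ((tendsto_pow_atTop two_ne_zero).comp tendsto_norm_cobounded_atTop)
  · refine Tendsto.mono_right (tendsto_principal.2 ?_) principal_le_nhdsSet
    filter_upwards [Bornology.eventually_ne_cobounded (0 : Wave)] with k hk
    rw [mem_sphere_zero_iff_norm, norm_smul, norm_inv, norm_norm,
      inv_mul_cancel₀ (norm_ne_zero_iff.2 hk)]

theorem contDiffAt_compactify {k : Wave} (hk : k ≠ 0) : ContDiffAt ℝ 1 compactify k := by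
  have h : ‖k‖ ≠ 0 := norm_ne_zero_iff.2 hk
  have hn : ContDiffAt ℝ 1 (fun k : Wave => ‖k‖) k := contDiffAt_norm ℝ hk
  exact ((hn.pow 2).inv (pow_ne_zero 2 h)).prodMk ((hn.inv h).smul contDiffAt_id)

theorem finite_norm_intWave_le (K : ℝ) : {n : Fin 3 → ℤ | ‖intWave n‖ ≤ K}.Finite := by
  refine (Set.finite_Icc (fun _ : Fin 3 => -⌈K⌉) fun _ => ⌈K⌉).subset fun n hn => ?_
  have h : ∀ i, |(n i : ℝ)| ≤ ⌈K⌉ := fun i =>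
    ((PiLp.norm_apply_le (intWave n) i).trans hn).trans (Int.le_ceil K)
  exact ⟨fun i => by exact_mod_cast (abs_le.1 (h i)).1, fun i => by exact_mod_cast (abs_le.1 (h i)).2⟩

theorem exists_unstable_branch (hp : p.Admissible) : ∃ (K : ℝ) (z : Wave → ℂ), 0 < K ∧
    (∀ k, K < ‖k‖ → ContDiffAt ℝ 1 z k ∧ IsEigenvalue (p.BHat k) (z k) ∧ 0 < (z k).re) ∧
    Tendsto z (Bornology.cobounded Wave) (𝓝 (I * p.d)) := by
  have hd : (p.d : ℂ) ≠ 0 := by exact_mod_cast hp.d_pos.ne'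
  have hm : (p.μ + p.κ / 2 : ℂ) ≠ 0 := by
    have : p.μ + p.κ / 2 ≠ 0 := by linarith [hp.μ_pos, hp.κ_pos]
    exact_mod_cast this
  have h1 : ∀ y ∈ limitSet, (y.1 : ℂ) * (I * p.d) + (p.μ + p.κ / 2) ≠ 0 := by
    rintro y ⟨hy, -⟩
    have : y.1 = 0 := hy
    simpa [this] using hm
  have h2 : I * (p.d : ℂ) + I * p.d ≠ 0 := by
    rw [← two_mul]
    exact mul_ne_zero two_ne_zero (mul_ne_zero I_ne_zero hd)
  have hc : ∀ y ∈ limitSet, ContDiffAt ℝ 1 p.correction (y, I * p.d) := fun y hy =>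
    contDiffAt_correction (h1 y hy) h2 (reducedMatrix_of_mem_limitSet hy hp _).1
  obtain ⟨z, hz⟩ := exists_contDiffAt_fixedPoint isCompact_limitSet (w₀ := I * p.d)
    (e := fun y : ℝ × Wave => (y.1 : ℂ)) (g := p.correction)
    (ofRealCLM.contDiff.comp contDiff_fst)
    (fun y hy => by have : y.1 = 0 := hy.1; simp [this]) hc
  have hzc : ∀ y ∈ limitSet, Tendsto z (𝓝 y) (𝓝 (I * p.d)) := fun y hy => by
    have := (hz y hy).2.1.continuousAt
    rwa [ContinuousAt, (hz y hy).1] at this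
  -- Each condition is open and holds on the limit set, where `z = i d`, except the fixed point
  -- equation, which is already known nearby.
  have hgood : ∀ᶠ y in 𝓝ˢ limitSet, ContDiffAt ℝ 1 z y ∧
      z y = I * p.d + y.1 * p.correction (y, z y) ∧ 0 < (p.correction (y, z y)).re ∧
      (p.reducedMatrix (y, z y)).det ≠ 0 ∧ (y.1 : ℂ) * z y + (p.μ + p.κ / 2) ≠ 0 ∧
      z y + I * p.d ≠ 0 := by
    refine eventually_nhdsSet_iff_forall.2 fun y hy => ?_
    have ht : Tendsto (fun y => (y, z y)) (𝓝 y) (𝓝 (y, I * p.d)) :=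
      tendsto_id.prodMk_nhds (hzc y hy)
    have hre := (continuous_re.continuousAt.comp (hc y hy).continuousAt).tendsto.comp ht
    have hdet := (continuousAt_det_reducedMatrix (p := p) (v := (y, I * p.d))
      (h1 y hy) h2).tendsto.comp ht
    have hden : Tendsto (fun y : ℝ × Wave => (y.1 : ℂ) * z y + (p.μ + p.κ / 2)) (𝓝 y)
        (𝓝 ((y.1 : ℂ) * (I * p.d) + (p.μ + p.κ / 2))) :=
      (Tendsto.mul (Continuous.tendsto (by fun_prop) y) (hzc y hy)).add_const _
    filter_upwards [(hz y hy).2.1.eventually (by simp), (hz y hy).2.2,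
      hre.eventually (lt_mem_nhds (reducedMatrix_of_mem_limitSet hy hp _).2),
      hdet.eventually_ne (reducedMatrix_of_mem_limitSet hy hp _).1,
      hden.eventually_ne (h1 y hy), ((hzc y hy).add_const (I * p.d)).eventually_ne h2]
      with y' a1 a2 a3 a4 a5 a6 using ⟨a1, a2, a3, a4, a5, a6⟩
  have hlim : Tendsto z (𝓝ˢ limitSet) (𝓝 (I * p.d)) := fun s hs =>
    mem_nhdsSet_iff_forall.2 fun y hy => hzc y hy hs
  obtain ⟨K, -, hK⟩ := (Metric.hasBasis_cobounded_compl_closedBall (0 : Wave)).eventually_iff.1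
    (tendsto_compactify.eventually hgood)
  -- The maximum with 1 makes the radius positive and excludes `k = 0`.
  refine ⟨max K 1, z ∘ compactify, by positivity, fun k hk => ?_, hlim.comp tendsto_compactify⟩
  have hk0 : k ≠ 0 := by
    rintro rfl
    rw [norm_zero] at hk
    exact absurd (le_max_right K 1) (by linarith)
  obtain ⟨a1, a2, a3, a4, a5, a6⟩ := hK (x := k) (by simpa using (le_max_left K 1).trans_lt hk)
  refine ⟨a1.comp k (contDiffAt_compactify hk0),
    isEigenvalue_BHat_of_fixedPoint hp hk0 rfl a4 a5 a6 a2, ?_⟩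
  have hε : 0 < (compactify k).1 := by
    have : 0 < ‖k‖ := norm_pos_iff.2 hk0
    exact inv_pos.2 (by positivity)
  -- Since `i d` is imaginary, the real part comes from the correction alone.
  have : (z (compactify k)).re
      = (compactify k).1 * (p.correction (compactify k, z (compactify k))).re := by
    conv_lhs => rw [a2]
    simp
  rw [Function.comp_apply, this]
  positivity

end Micropolar

/-! ### The main theorem -/

theorem mainTheorem6 (p : Micropolar.Params) (hp : p.Admissible) :
    (∃ (K : ℝ) (z : Micropolar.Wave → ℂ),
      0 < K ∧
      ContDiffOn ℝ 1 z {k | K < ‖k‖} ∧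
      (∀ k : Micropolar.Wave, K < ‖k‖ →
        Micropolar.IsEigenvalue (p.M k) (z k) ∧
        Micropolar.IsEigenvalue (p.M k) (starRingEnd ℂ (z k)) ∧
        0 < (z k).re) ∧
      Filter.Tendsto z (Bornology.cobounded Micropolar.Wave)
        (nhds (Complex.I * (p.τ : ℂ) / (2 * (p.κ : ℂ))))) ∧
    -- all but finitely many Fourier modes are unstable
    {n : Fin 3 → ℤ | ¬ Micropolar.UnstableMode p n}.Finite ∧
    -- no spectral gap: the unstable spectrum is not bounded away from the imaginary axis
    (∀ δ : ℝ, 0 < δ → ∃ w : ℂ, Micropolar.IsEigenvalueLin p w ∧ 0 < w.re ∧ w.re < δ) := by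
  obtain ⟨K, z, hK, hz, hlim⟩ := Micropolar.exists_unstable_branch hp
  refine ⟨⟨K, z, hK, fun k hk => (hz k hk).1.contDiffWithinAt, fun k hk => ?_, ?_⟩, ?_, ?_⟩
  · obtain ⟨-, hev, hre⟩ := hz k hk
    have hk0 : k ≠ 0 := norm_pos_iff.1 (hK.trans hk)
    have hz0 : z k ≠ 0 := fun h => by simp [h] at hre
    exact ⟨hev.M_of_BHat hp hk0 hz0, hev.BHat_conj.M_of_BHat hp hk0 (by simpa using hz0), hre⟩
  · convert hlim using 2
    rw [Micropolar.Params.d]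
    push_cast
    ring
  · refine (Micropolar.finite_norm_intWave_le K).subset fun n hn => ?_
    by_contra h
    have h' : K < ‖Micropolar.intWave n‖ := not_le.1 h
    exact hn ⟨_, (hz _ h').2.1, (hz _ h').2.2⟩
  · intro δ hδ
    have hre : Filter.Tendsto (fun k => (z k).re) (Bornology.cobounded Micropolar.Wave)
        (nhds 0) := by
      have := (Complex.continuous_re.tendsto _).comp hlim
      simpa [Function.comp_def] using this
    obtain ⟨R, -, hR⟩ := (Metric.hasBasis_cobounded_compl_closedBall
      (0 : Micropolar.Wave)).eventually_iff.1 (hre.eventually (gt_mem_nhds hδ))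
    -- `ℤ³` is infinite, so some integer wavenumber lies beyond both radii.
    obtain ⟨n, hn⟩ := (Micropolar.finite_norm_intWave_le (max K R)).exists_notMem
    have hn' : max K R < ‖Micropolar.intWave n‖ := not_le.1 hn
    have hnK := (le_max_left K R).trans_lt hn'
    exact ⟨_, Micropolar.isEigenvalueLin_of_isEigenvalue p (hz _ hnK).2.1, (hz _ hnK).2.2,
      hR (by simpa using (le_max_right K R).trans_lt hn')⟩
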